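/- A group is CSA if all of its maximal abelian subgroups are malnormal. Let $\Gamma=G\rtimes_\alpha\langle t\rangle$ be a semidirect product with $\langle t\rangle$ infinite cyclic. A $\Gamma$-tree is a simplicial tree with an action of $\Gamma$ without edge inversions; it is minimal if it has no proper nonempty $\Gamma$-invariant subtree. Let $T$ be a $\Gamma$-tree that is bipartite in such a way that the $\Gamma$-stabilizers of the vertices of one colour (the black vertices) are abelian and those of the other colour (the white vertices) are not abelian. One says that $\Gamma$ is a piecewise trivial suspension over $(G,T)$ if for every vertex $v$ of $T$ there is an element $t_v\in Gt$ such that $\mathrm{Stab}_\Gamma(v)$ is the internal direct product $\mathrm{Stab}_G(v)\times\langle t_v\rangle$ and such that, if $v$ is white, the fixed point set of every nontrivial power of $t_v$ is exactly the ball of radius $2$ around $v$. **Proposition.** Suppose that a group $\Gamma$ contains CSA subgroups $G,G'$ such that \[G\rtimes_\alpha\langle t\rangle=\Gamma=G'\rtimes_{\alpha'}\langle t'\rangle ,\] and that $\Gamma$ is a piecewise trivial suspension over both $(G,T)$ and $(G',T')$, where $T$ and $T'$ are minimal $\Gamma$-trees. Then there is a $\Gamma$-equivariant isomorphism of trees $f:T\to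 T'$. -/

import Mathlib

namespace PiecewiseTrivial

/-- A subgroup `M` is malnormal if `g M g⁻¹ ∩ M` is trivial for every `g ∉ M`. -/
def IsMalnormal {G : Type*} [Group G] (M : Subgroup G) : Prop :=
  ∀ g : G, g ∉ M → ∀ x : G, x ∈ M → g * x * g⁻¹ ∈ M → x = 1

/-- A group is CSA if all of its maximal abelian subgroups are malnormal. -/
def IsCSA (G : Type*) [Group G] : Prop :=
  ∀ M : Subgroup G, Maximal (fun A : Subgroup G => IsMulCommutative A) M → IsMalnormal M

/-- `Γ = G ⋊_α ⟨t⟩` as an internal semidirect product: `G` is normal, `⟨t⟩` is an infinite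
cyclic complement of `G`, and the conjugation `g ↦ t⁻¹ g t` induces `α` on `G`. -/
structure IsSuspension {Γ : Type*} [Group Γ] (G : Subgroup Γ) (α : MulAut G) (t : Γ) :
    Prop where
  normal : G.Normal
  isComplement : Subgroup.IsComplement' G (Subgroup.zpowers t)
  infinite_order : ¬ IsOfFinOrder t
  conj_eq : ∀ g : G, t⁻¹ * (g : Γ) * t = (α g : Γ)

/-- A `Γ`-tree: a tree with an action of `Γ` by graph automorphisms, without edge inversion. -/
structure IsGroupTree (Γ : Type*) [Group Γ] {V : Type*} [MulAction Γ V] (T : SimpleGraph V) :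
    Prop where
  isTree : T.IsTree
  adj_smul : ∀ (g : Γ) (v w : V), T.Adj v w → T.Adj (g • v) (g • w)
  no_inversion : ∀ (g : Γ) (v w : V), T.Adj v w → ¬ (g • v = w ∧ g • w = v)

/-- The `Γ`-tree `T` is minimal: it has no proper (nonempty) `Γ`-invariant subtree. Subtrees of a
tree are given by the sets of vertices that induce a connected subgraph. -/
def IsMinimalTree (Γ : Type*) [Group Γ] {V : Type*} [MulAction Γ V] (T : SimpleGraph V) : Prop :=
  ∀ S : Set V, (T.induce S).Connected → (∀ (g : Γ), ∀ v ∈ S, g • v ∈ S) → S = Set.univ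

/-- Black vertices are those with abelian stabilizer in `Γ`; the others are white. -/
def IsBlack (Γ : Type*) [Group Γ] {V : Type*} [MulAction Γ V] (v : V) : Prop :=
  IsMulCommutative (MulAction.stabilizer Γ v)

/-- `T` is bipartite with respect to the class of abelian subgroups: there is a bipartition of its
vertices for which the stabilizers of one colour are abelian and those of the other colour are not.
Such a bipartition can only be the one into black and white vertices. -/
def IsAbelianBipartite (Γ : Type*) [Group Γ] {V : Type*} [MulAction Γ V] (T : SimpleGraph V) :
    Prop :=
  ∀ v w : V, T.Adj v w → (IsBlack Γ v ↔ ¬ IsBlack Γ w)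

/-- The subgroup `C` is the internal direct product of its subgroups `A` and `B`. -/
structure IsInternalDirectProduct {Γ : Type*} [Group Γ] (C A B : Subgroup Γ) : Prop where
  sup_eq : A ⊔ B = C
  inf_eq : A ⊓ B = ⊥
  comm : ∀ a ∈ A, ∀ b ∈ B, a * b = b * a

/-- For `Γ = G ⋊ ⟨t⟩` and a `Γ`-tree `T`: `Γ` is a piecewise trivial suspension over `(G, T)`.
Each vertex `v` has an element `t_v` in the coset `G t` such that `Stab_Γ(v)` is the direct product
of `Stab_G(v)` and `⟨t_v⟩`, and if `v` is white then every nontrivial power of `t_v` fixes exactly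
the ball of radius `2` around `v`. -/
structure IsPiecewiseTrivialSuspension {Γ : Type*} [Group Γ] (G : Subgroup Γ) (t : Γ)
    {V : Type*} [MulAction Γ V] (T : SimpleGraph V) : Prop where
  isGroupTree : IsGroupTree Γ T
  bipartite : IsAbelianBipartite Γ T
  exists_central : ∀ v : V, ∃ tv : Γ, (∃ g ∈ G, tv = g * t) ∧
    IsInternalDirectProduct (MulAction.stabilizer Γ v) (MulAction.stabilizer Γ v ⊓ G)
      (Subgroup.zpowers tv) ∧
    (¬ IsBlack Γ v → ∀ n : ℤ, n ≠ 0 → ∀ w : V, tv ^ n • w = w ↔ T.dist v w ≤ 2)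

end PiecewiseTrivial

namespace PiecewiseTrivial

/-! ### Geodesics and bi-infinite lines in trees. -/

section Tree

variable {V : Type*} {T : SimpleGraph V}

/-! The tree is recovered from the group `Γ` alone. For white `v`, an element commuting with a
nontrivial power of `t_v` preserves its fixed set, a ball that determines its centre `v`; so the
centralizer of that power is exactly the stabilizer of `v` (`commute_gen_zpow_iff`).

Conversely, a nontrivial element `x` with nonabelian centralizer is such a power
(`exists_eq_gen_zpow`). If `x` had an axis, commutators of elements of its centralizer would lie in
`G` and fix the axis, while the CSA property makes elements of `G` fixing two edges at a white
vertex trivial. If `x` has a fixed vertex but is no power of a `t_v`, its centralizer fixes a black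
vertex, or lies in some `Stab_G(v) × ⟨t_v⟩` and centralizes a nontrivial element of `Stab_G(v)`;
both make it abelian.

Hence the white stabilizers are the nonabelian centralizers of nontrivial elements, and
`dist_le_two_iff` expresses distance at most 2 between white vertices through `Γ`. A black vertex is
determined by any two of its neighbours, which are white and at distance 2. All these data agree for
`T` and `T'`, so matching them gives the isomorphism. If `Γ` is abelian, both trees are points. -/

theorem exists_adj_dist_add_one (hT : T.Connected) {r x : V} (h : x ≠ r) :
    ∃ y, T.Adj x y ∧ T.dist r y + 1 = T.dist r x := by
  obtain ⟨w, hw⟩ := hT.exists_walk_length_eq_dist x r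
  cases w with
  | nil => exact absurd rfl h
  | @cons _ y _ hxy w =>
    refine ⟨y, hxy, ?_⟩
    have h1 := SimpleGraph.dist_le w
    have h2 := hT.dist_triangle (u := x) (v := y) (w := r)
    rw [SimpleGraph.dist_eq_one_iff_adj.2 hxy] at h2
    rw [SimpleGraph.Walk.length_cons] at hw
    rw [T.dist_comm (u := r) (v := y), T.dist_comm (u := r) (v := x)]
    omega

theorem eq_of_adj_of_dist_lt (hT : T.IsTree) {r x y z : V} (hy : T.Adj x y) (hz : T.Adj x z)
    (hyr : T.dist r y < T.dist r x) (hzr : T.dist r z < T.dist r x) : y = z := by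
  have key : ∀ y, T.Adj x y → T.dist r y < T.dist r x →
      ∃ w : T.Walk x r, w.IsPath ∧ w.snd = y := by
    intro y hy hyr
    obtain ⟨w, hw⟩ := hT.connected.exists_walk_length_eq_dist y r
    refine ⟨SimpleGraph.Walk.cons hy w, SimpleGraph.Walk.isPath_of_length_eq_dist _ ?_, by simp⟩
    have := hT.dist_eq_dist_add_one_of_adj r hy
    rw [SimpleGraph.Walk.length_cons, hw, T.dist_comm (u := x), T.dist_comm (u := y)]
    omega
  obtain ⟨w, hw, rfl⟩ := key y hy hyr
  obtain ⟨w', hw', rfl⟩ := key z hz hzr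
  rw [(hT.existsUnique_path x r).unique hw hw']

theorem dist_add_one_of_adj (hT : T.IsTree) {r x y z : V} (hy : T.Adj x y) (hz : T.Adj x z)
    (hyr : T.dist r y < T.dist r x) (hyz : y ≠ z) : T.dist r z = T.dist r x + 1 := by
  have h := hT.dist_eq_dist_add_one_of_adj r hz
  by_contra h'
  exact hyz (eq_of_adj_of_dist_lt hT hy hz hyr (by omega))

theorem dist_eq_two (hT : T.IsTree) {x y z : V} (hy : T.Adj x y) (hz : T.Adj x z)
    (hyz : y ≠ z) : T.dist y z = 2 := by
  have hd : T.dist y x = 1 := SimpleGraph.dist_eq_one_iff_adj.2 hy.symm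
  rw [dist_add_one_of_adj (r := y) hT hy hz (by simp [hd]) hyz, hd]

/-- A sequence of vertices without backtracking that starts by moving away from `r` keeps moving
away from `r`. -/
theorem dist_eq_add_of_nonbacktracking (hT : T.IsTree) {r : V} (q : ℕ → V)
    (hadj : ∀ n, T.Adj (q n) (q (n + 1))) (hne : ∀ n, q n ≠ q (n + 2))
    (h1 : T.dist r (q 0) ≤ T.dist r (q 1)) (n : ℕ) : T.dist r (q n) = T.dist r (q 0) + n := by
  have key : ∀ n, T.dist r (q (n + 1)) = T.dist r (q n) + 1 := by
    intro n
    induction n with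
    | zero =>
      have := hT.dist_eq_dist_add_one_of_adj r (hadj 0)
      simp only [zero_add] at this ⊢
      omega
    | succ n ih =>
      exact dist_add_one_of_adj hT (hadj n).symm (hadj (n + 1)) (by omega) (hne n)
  induction n with
  | zero => rfl
  | succ n ih => rw [key, ih, add_assoc]

/-- A bi-infinite sequence of vertices without backtracking is geodesic away from a closest point
to `x`. -/
theorem dist_line (hT : T.IsTree) (p : ℤ → V)
    (hadj : ∀ n, T.Adj (p n) (p (n + 1))) (hne : ∀ n, p n ≠ p (n + 2)) {x : V} {m : ℤ}
    (hm : ∀ n, T.dist x (p m) ≤ T.dist x (p n)) (n : ℤ) :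
    (T.dist x (p n) : ℤ) = T.dist x (p m) + |n - m| := by
  rcases le_total m n with h | h
  · have := dist_eq_add_of_nonbacktracking hT (r := x) (fun k => p (m + k))
      (fun k => by simpa [add_assoc] using hadj (m + k))
      (fun k => by simpa [add_assoc] using hne (m + k)) (by simpa using hm (m + 1)) (n - m).toNat
    have e : m + ((n - m).toNat : ℤ) = n := by omega
    simp only [e, Nat.cast_zero, add_zero] at this
    rw [abs_of_nonneg (by omega), this]
    omega
  · have := dist_eq_add_of_nonbacktracking hT (r := x) (fun k => p (m - k))
      (fun k => by
        have := (hadj (m - (k + 1))).symm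
        rw [show m - ((k : ℤ) + 1) + 1 = m - k by ring] at this
        simpa using this)
      (fun k => by
        have := (hne (m - (k + 2))).symm
        rw [show m - ((k : ℤ) + 2) + 2 = m - k by ring] at this
        simpa using this) (by simpa using hm (m - 1)) (m - n).toNat
    have e : m - ((m - n).toNat : ℤ) = n := by omega
    simp only [e, Nat.cast_zero, sub_zero] at this
    rw [abs_of_nonpos (by omega), this]
    omega

theorem dist_line_line (hT : T.IsTree) (p : ℤ → V)
    (hadj : ∀ n, T.Adj (p n) (p (n + 1))) (hne : ∀ n, p n ≠ p (n + 2)) (m n : ℤ) :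
    (T.dist (p m) (p n) : ℤ) = |n - m| := by
  simpa using dist_line hT p hadj hne (x := p m) (m := m) (by simp) n

/-- Off the line `p`, at most one neighbour of a vertex is at most as far from `p` as it. -/
theorem eq_of_adj_of_iInf_dist_le (hT : T.IsTree) (p : ℤ → V)
    (hadj : ∀ n, T.Adj (p n) (p (n + 1))) (hne : ∀ n, p n ≠ p (n + 2)) {x y z : V}
    (hx : 0 < ⨅ n, T.dist x (p n)) (hy : T.Adj x y) (hz : T.Adj x z)
    (hyx : ⨅ n, T.dist y (p n) ≤ ⨅ n, T.dist x (p n))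
    (hzx : ⨅ n, T.dist z (p n) ≤ ⨅ n, T.dist x (p n)) : y = z := by
  obtain ⟨m, hm⟩ := ciInf_mem (fun n => T.dist x (p n))
  have hmin : ∀ n, T.dist x (p m) ≤ T.dist x (p n) := fun n => by
    exact hm.trans_le (ciInf_le' _ n)
  have hline := dist_line hT p hadj hne hmin
  simp only at hm
  rw [← hm] at hx hyx hzx
  obtain ⟨r, hxr, hr⟩ := exists_adj_dist_add_one hT.connected (r := p m) (x := x) (by
    rintro rfl
    simp at hx)
  -- With `p k` closest to `y`, both `y` and `r` are nearer to `p k` than `x` is: the distance from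
  -- `x` to `p k` is attained by going through `p m`.
  have key : ∀ y, T.Adj x y → ⨅ n, T.dist y (p n) ≤ T.dist x (p m) → y = r := by
    intro y hy hyx
    obtain ⟨k, hk⟩ := ciInf_mem (fun n => T.dist y (p n))
    simp only at hk
    rw [← hk] at hyx
    have h1 := hline k
    have h2 := hT.connected.dist_triangle (u := r) (v := p m) (w := p k)
    have h3 := dist_line_line hT p hadj hne m k
    have h4 := hT.dist_eq_dist_add_one_of_adj (p k) hy
    rw [T.dist_comm (u := p m), T.dist_comm (u := p m) (v := x)] at hr
    rw [T.dist_comm (u := p k), T.dist_comm (u := p k) (v := y)] at h4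
    have h5 := abs_nonneg (k - m)
    refine eq_of_adj_of_dist_lt (r := p k) hT hy hxr ?_ ?_ <;>
      rw [T.dist_comm (u := p k), T.dist_comm (u := p k) (v := x)] <;> omega
  rw [key y hy hyx, key z hz hzx]

end Tree

/-! ### Actions on trees, and axes. -/

section Action

variable {Γ : Type*} [Group Γ] {V : Type*} [MulAction Γ V] {T : SimpleGraph V}

theorem IsGroupTree.dist_smul (hT : IsGroupTree Γ T) (g : Γ) (x y : V) :
    T.dist (g • x) (g • y) = T.dist x y := by
  have key : ∀ (g : Γ) (x y : V), T.dist (g • x) (g • y) ≤ T.dist x y := by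
    intro g x y
    obtain ⟨w, hw⟩ := hT.isTree.connected.exists_walk_length_eq_dist x y
    let φ : T →g T := ⟨fun v => g • v, fun {a b} h => hT.adj_smul g a b h⟩
    have := SimpleGraph.dist_le (w.map φ)
    rwa [SimpleGraph.Walk.length_map, hw] at this
  refine le_antisymm (key g x y) ?_
  simpa using key g⁻¹ (g • x) (g • y)

theorem IsGroupTree.adj_smul_iff (hT : IsGroupTree Γ T) (g : Γ) (x y : V) :
    T.Adj (g • x) (g • y) ↔ T.Adj x y :=
  ⟨fun h => by simpa using hT.adj_smul g⁻¹ _ _ h, hT.adj_smul g x y⟩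

/-- Fixed sets are convex: the geodesic between two fixed vertices is unique, so its first edge is
fixed. -/
theorem IsGroupTree.smul_eq_of_closer (hT : IsGroupTree Γ T) {g : Γ} {x r y : V}
    (hx : g • x = x) (hr : g • r = r) (hy : T.Adj x y) (hyr : T.dist r y < T.dist r x) :
    g • y = y := by
  refine eq_of_adj_of_dist_lt (r := r) hT.isTree (x := x) ?_ hy ?_ hyr
  · have := hT.adj_smul g _ _ hy
    rwa [hx] at this
  · have := hT.dist_smul g r y
    rw [hr] at this
    omega

/-- An automorphism without fixed vertex translates a line. -/
theorem IsGroupTree.exists_axis (hT : IsGroupTree Γ T) {c : Γ} (hc : ∀ x : V, c • x ≠ x) :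
    ∃ (l : ℕ) (p : ℤ → V), 0 < l ∧ (∀ n, p (n + l) = c • p n) ∧
      (∀ n, T.Adj (p n) (p (n + 1))) ∧ (∀ n, p n ≠ p (n + 2)) := by
  have hconn := hT.isTree.connected
  -- The axis is the union of the `c`-translates of a geodesic from a vertex of minimal displacement
  -- to its image.
  obtain ⟨x, hx⟩ : ∃ x : V, ∀ y : V, T.dist x (c • x) ≤ T.dist y (c • y) := by
    have : Nonempty V := hconn.nonempty
    obtain ⟨x, hx⟩ := ciInf_mem (fun x : V => T.dist x (c • x))
    exact ⟨x, fun y => hx.trans_le (ciInf_le' _ y)⟩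
  obtain ⟨w, hw⟩ := hconn.exists_walk_length_eq_dist x (c • x)
  set l := T.dist x (c • x) with hl
  have hlpos : 0 < l := hconn.pos_dist_of_ne (hc x).symm
  have hdist : ∀ i j, i ≤ j → j ≤ l → T.dist (w.getVert i) (w.getVert j) = j - i := by
    intro i j hij hj
    have h0 : ∀ i ≤ l, T.dist x (w.getVert i) ≤ i := fun i hi =>
      (SimpleGraph.dist_le (w.take i)).trans (by simp)
    have h1 : T.dist (w.getVert j) (c • x) ≤ l - j :=
      (SimpleGraph.dist_le (w.drop j)).trans (by simp [hw])
    have h2 : T.dist (w.getVert i) (w.getVert j) ≤ j - i := by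
      have := SimpleGraph.dist_le ((w.drop i).take (j - i))
      have e : (w.drop i).getVert (j - i) = w.getVert j := by
        rw [SimpleGraph.Walk.drop_getVert, show i + (j - i) = j by omega]
      exact (congrArg (T.dist (w.getVert i)) e).symm.trans_le (this.trans (by simp))
    have h3 := hconn.dist_triangle (u := x) (v := w.getVert i) (w := w.getVert j)
    have h4 := hconn.dist_triangle (u := x) (v := w.getVert j) (w := c • x)
    have := h0 i (by omega)
    omega
  have hgl : w.getVert l = c • x := by rw [← hw]; exact w.getVert_length
  let p : ℤ → V := fun n => c ^ (n / (l : ℤ)) • w.getVert (n % l).toNat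
  have hp : ∀ (q : ℤ) (i : ℕ), i ≤ l → p (q * l + i) = c ^ q • w.getVert i := by
    intro q i hi
    rcases hi.lt_or_eq with hi | hi
    · have h1 : (q * (l : ℤ) + i) / l = q := by
        rw [add_comm, Int.add_mul_ediv_right _ _ (by omega),
          Int.ediv_eq_zero_of_lt (by omega) (by omega), zero_add]
      have h2 : (q * (l : ℤ) + i) % l = i := by
        rw [add_comm, Int.add_mul_emod_self_right, Int.emod_eq_of_lt (by omega) (by omega)]
      simp only [p, h1, h2, Int.toNat_natCast]
    · have h1 : (q * (l : ℤ) + l) / l = q + 1 := by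
        rw [← add_one_mul, Int.mul_ediv_cancel _ (by omega)]
      have h2 : (q * (l : ℤ) + l) % l = 0 := by
        rw [← add_one_mul, Int.mul_emod_left]
      simp only [p, hi, h1, h2, Int.toNat_zero, hgl, SimpleGraph.Walk.getVert_zero, zpow_add_one,
        mul_smul]
  have hdecomp : ∀ n : ℤ, ∃ (q : ℤ) (i : ℕ), i < l ∧ n = q * l + i := fun n =>
    ⟨n / l, (n % l).toNat, by
      have := Int.emod_lt_of_pos n (show (0 : ℤ) < l by omega)
      omega, by
      rw [Int.toNat_of_nonneg (Int.emod_nonneg _ (by omega)), mul_comm, Int.mul_ediv_add_emod]⟩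
  refine ⟨l, p, hlpos, ?_, ?_, ?_⟩
  · intro n
    obtain ⟨q, i, hi, rfl⟩ := hdecomp n
    rw [show q * (l : ℤ) + i + l = (q + 1) * l + i by ring, hp _ _ hi.le, hp _ _ hi.le,
      add_comm q, zpow_add, zpow_one, mul_smul]
  · intro n
    obtain ⟨q, i, hi, rfl⟩ := hdecomp n
    rw [hp _ _ hi.le, show q * (l : ℤ) + i + 1 = q * l + (i + 1 : ℕ) by push_cast; ring,
      hp _ _ (by omega)]
    refine hT.adj_smul _ _ _ ?_
    rw [← SimpleGraph.dist_eq_one_iff_adj, hdist _ _ (by omega) (by omega)]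
    omega
  · intro n
    obtain ⟨q, i, hi, rfl⟩ := hdecomp n
    rw [hp _ _ hi.le]
    by_cases h : i + 2 ≤ l
    · rw [show q * (l : ℤ) + i + 2 = q * l + (i + 2 : ℕ) by push_cast; ring, hp _ _ h,
        smul_left_cancel_iff .. |>.ne]
      intro he
      have := hdist i (i + 2) (by omega) h
      rw [he, SimpleGraph.dist_self] at this
      omega
    -- Backtracking where two translates meet would give `w.getVert 1` displacement `l - 2`, or,
    -- when `l = 1`, make `c` invert an edge.
    · have hil : i = l - 1 := by omega
      rw [show q * (l : ℤ) + i + 2 = (q + 1) * l + (1 : ℕ) by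
          rw [hil, Nat.cast_sub (by omega)]; push_cast; ring, hp _ _ (by omega),
        zpow_add_one, mul_smul, smul_left_cancel_iff .. |>.ne, hil]
      intro he
      by_cases h2 : 2 ≤ l
      · have h3 := hx (w.getVert 1)
        rw [← he, hdist _ _ (by omega) (by omega)] at h3
        omega
      · have h1 : l = 1 := by omega
        have h0 : T.Adj x (c • x) := by
          rw [← SimpleGraph.dist_eq_one_iff_adj, ← hl, h1]
        rw [h1, ← h1, hgl, h1, Nat.sub_self, SimpleGraph.Walk.getVert_zero] at he
        exact hT.no_inversion c _ _ h0 ⟨rfl, he.symm⟩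

end Action

open scoped commutatorElement

/-! ### Centralizers act on axes. -/

section Axis

variable {Γ : Type*} [Group Γ] {V : Type*} [MulAction Γ V] {T : SimpleGraph V}

/-- An element commuting with `c` preserves a line translated by `c`. -/
theorem IsGroupTree.smul_mem_axis (hT : IsGroupTree Γ T) {c z : Γ} {l : ℕ} {p : ℤ → V}
    (hl : 0 < l) (hp : ∀ n, p (n + l) = c • p n) (hadj : ∀ n, T.Adj (p n) (p (n + 1)))
    (hne : ∀ n, p n ≠ p (n + 2)) (hz : Commute z c) (j : ℤ) : ∃ k, z • p j = p k := by
  let h : V → ℕ := fun x => ⨅ n, T.dist x (p n)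
  have hle : ∀ x, h (c • x) ≤ h x := by
    intro x
    obtain ⟨n, hn⟩ := ciInf_mem (fun n => T.dist x (p n))
    refine (ciInf_le' _ (n + l)).trans (le_of_eq ?_)
    rw [hp, hT.dist_smul]
    exact hn
  have hge : ∀ x, h x ≤ h (c • x) := by
    intro x
    obtain ⟨n, hn⟩ := ciInf_mem (fun n => T.dist (c • x) (p n))
    refine (ciInf_le' _ (n - l)).trans (le_of_eq ?_)
    rw [← hT.dist_smul c, ← hp, sub_add_cancel]
    exact hn
  have hzp : ∀ n : ℤ, z • p (n + l) = c • z • p n := fun n => by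
    rw [hp, ← mul_smul, hz.eq, mul_smul]
  have hzp' : ∀ n : ℤ, h (z • p (n + l)) = h (z • p n) := fun n => by
    rw [hzp]; exact le_antisymm (hle _) (hge _)
  have hzadj : ∀ n, T.Adj (z • p n) (z • p (n + 1)) := fun n => hT.adj_smul _ _ _ (hadj n)
  have hzne : ∀ n, z • p n ≠ z • p (n + 2) := fun n => (smul_left_cancel_iff z).ne.2 (hne n)
  have huniq : ∀ {x y w : V}, 0 < h x → T.Adj x y → T.Adj x w → y ≠ w → h y ≤ h x → h x < h w :=
    fun hx hy hw hyw hyx => lt_of_not_ge fun hwx =>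
      hyw (eq_of_adj_of_iInf_dist_le hT.isTree p hadj hne hx hy hw hyx hwx)
  have hescape : ∀ q : ℕ → V, (∀ n, T.Adj (q n) (q (n + 1))) → (∀ n, q n ≠ q (n + 2)) →
      h (q 0) < h (q 1) → ∀ n, h (q 0) < h (q (n + 1)) := by
    intro q hq hq' h0 n
    have key : ∀ n, h (q 0) ≤ h (q n) ∧ h (q n) < h (q (n + 1)) := by
      intro n
      induction n with
      | zero => exact ⟨le_rfl, h0⟩
      | succ n ih =>
        exact ⟨by omega, huniq (by omega) (hq n).symm (hq (n + 1)) (hq' n) ih.2.le⟩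
    exact (key n).1.trans_lt (key n).2
  -- The height `h` is `l`-periodic along the line `z • p`. If positive at some point, it would
  -- increase strictly in one of the two directions and never return; `hescape` at `l - 1`
  -- contradicts this after one full period.
  have hzero : h (z • p j) = 0 := by
    by_contra hpos
    have hor : h (z • p j) < h (z • p (j + 1)) ∨ h (z • p j) < h (z • p (j - 1)) := by
      by_contra hcon
      push Not at hcon
      have h1 := hzadj (j - 1)
      have h2 := hzne (j - 1)
      rw [sub_add_cancel] at h1
      rw [show j - 1 + 2 = j + 1 by ring] at h2
      have := huniq (Nat.pos_of_ne_zero hpos) h1.symm (hzadj j) h2 hcon.2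
      omega
    rcases hor with h0 | h0
    · have := hescape (fun n => z • p (j + n))
        (fun n => by simpa [add_assoc] using hzadj (j + n))
        (fun n => by simpa [add_assoc] using hzne (j + n)) (by simpa using h0) (l - 1)
      simp only [Nat.cast_zero, add_zero, Nat.sub_add_cancel hl, hzp' j, lt_irrefl] at this
    · have := hescape (fun n => z • p (j - n))
        (fun n => by
          have := (hzadj (j - (n + 1))).symm
          rw [show j - ((n : ℤ) + 1) + 1 = j - n by ring] at this
          simpa using this)
        (fun n => by
          have := (hzne (j - (n + 2))).symm
          rw [show j - ((n : ℤ) + 2) + 2 = j - n by ring] at this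
          simpa using this) (by simpa using h0) (l - 1)
      have h1 := hzp' (j - l)
      rw [sub_add_cancel] at h1
      simp only [Nat.cast_zero, sub_zero, Nat.sub_add_cancel hl, h1, lt_irrefl] at this
  obtain ⟨n, hn⟩ := ciInf_mem (fun n => T.dist (z • p j) (p n))
  exact ⟨n, hT.isTree.connected.dist_eq_zero_iff.1 (hn.trans hzero)⟩

/-- An element commuting with `c` translates a line translated by `c`. -/
theorem IsGroupTree.exists_smul_axis (hT : IsGroupTree Γ T) {c z : Γ} {l : ℕ} {p : ℤ → V}
    (hl : 0 < l) (hp : ∀ n, p (n + l) = c • p n) (hadj : ∀ n, T.Adj (p n) (p (n + 1)))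
    (hne : ∀ n, p n ≠ p (n + 2)) (hz : Commute z c) : ∃ k, ∀ j, z • p j = p (j + k) := by
  have hmul : ∀ (n : ℕ) (j : ℤ), z • p (j + n * l) = c ^ n • z • p j := by
    intro n j
    induction n with
    | zero => simp
    | succ n ih =>
      rw [show j + ((n + 1 : ℕ) : ℤ) * l = j + n * l + l by push_cast; ring, hp, ← mul_smul,
        hz.eq, mul_smul, ih, pow_succ', mul_smul]
  have hmul' : ∀ (n : ℕ) (j : ℤ), p (j + n * l) = c ^ n • p j := by
    intro n j
    induction n with
    | zero => simp
    | succ n ih =>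
      rw [show j + ((n + 1 : ℕ) : ℤ) * l = j + n * l + l by push_cast; ring, hp, ih, pow_succ',
        mul_smul]
  have hdist := dist_line_line hT.isTree p hadj hne
  obtain ⟨k, hk⟩ := hT.smul_mem_axis hl hp hadj hne hz 0
  refine ⟨k, fun j => ?_⟩
  obtain ⟨s, hs⟩ := hT.smul_mem_axis hl hp hadj hne hz j
  rw [hs]
  congr 1
  have h1 := hdist 0 j
  rw [← hT.dist_smul z, hk, hs, hdist] at h1
  -- The distance to `p 0` leaves open whether `z` reverses the line. A second reference point,
  -- beyond `j`, whose image is known because `z` commutes with `c`, excludes this.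
  have h2 := hdist (0 + ((j.natAbs + 1 : ℕ) : ℤ) * l) j
  rw [← hT.dist_smul z, hmul, hk, hs, ← hmul', hdist] at h2
  have h3 : (j.natAbs : ℤ) + 1 ≤ ((j.natAbs + 1 : ℕ) : ℤ) * l := by
    exact_mod_cast Nat.le_mul_of_pos_right (j.natAbs + 1) hl
  rw [abs_eq_abs] at h1 h2
  omega

/-- Both `a` and `b` translate the axis of `c`, and translations of a line commute, so the
commutator fixes the axis pointwise. -/
theorem IsGroupTree.exists_commutator_fix (hT : IsGroupTree Γ T) {a b c : Γ}
    (hc : ∀ x : V, c • x ≠ x) (ha : Commute a c) (hb : Commute b c) :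
    ∃ x y : V, 3 ≤ T.dist x y ∧ ⁅a, b⁆ • x = x ∧ ⁅a, b⁆ • y = y := by
  obtain ⟨l, p, hl, hp, hadj, hne⟩ := hT.exists_axis hc
  obtain ⟨i, hi⟩ := hT.exists_smul_axis hl hp hadj hne ha
  obtain ⟨j, hj⟩ := hT.exists_smul_axis hl hp hadj hne hb
  have hfix : ∀ n, ⁅a, b⁆ • p n = p n := by
    intro n
    have h1 : a • b • p (n - i - j) = p n := by rw [hj, hi]; congr 1; ring
    have h2 : b • a • p (n - i - j) = p n := by rw [hi, hj]; congr 1; ring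
    have h3 : ⁅a, b⁆ • b • a • p (n - i - j) = a • b • p (n - i - j) := by
      rw [commutatorElement_def]
      simp [mul_smul]
    rwa [h1, h2] at h3
  refine ⟨p 0, p 3, ?_, hfix 0, hfix 3⟩
  have := dist_line_line hT.isTree p hadj hne 0 3
  norm_num at this
  omega

end Axis

/-! ### Commutation in CSA groups; the abelian quotient `Γ / G`. -/

section CSA

theorem exists_maximal_isMulCommutative {G : Type*} [Group G] (A : Subgroup G)
    (hA : IsMulCommutative A) :
    ∃ M, A ≤ M ∧ Maximal (fun A : Subgroup G => IsMulCommutative A) M := by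
  refine zorn_le_nonempty₀ {A : Subgroup G | IsMulCommutative A} ?_ A hA
  intro c hc hchain y hy
  refine ⟨sSup c, ?_, fun z hz => le_sSup hz⟩
  change IsMulCommutative _
  rw [isMulCommutative_iff]
  rintro ⟨a, ha⟩ ⟨b, hb⟩
  rw [Subgroup.mem_sSup_of_directedOn ⟨y, hy⟩ hchain.directedOn] at ha hb
  obtain ⟨s, hs, has⟩ := ha
  obtain ⟨u, hu, hbu⟩ := hb
  obtain ⟨w, hw, hsw, huw⟩ := hchain.directedOn s hs u hu
  have : IsMulCommutative w := hc hw
  exact Subtype.ext (setLike_mul_comm (hsw has) (huw hbu))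

/-- Commutation is transitive on the nontrivial elements of a CSA group. -/
theorem IsCSA.commute_trans {G : Type*} [Group G] (hG : IsCSA G) {x y z : G} (hx : x ≠ 1)
    (hy : Commute y x) (hz : Commute z x) : Commute y z := by
  have hab : IsMulCommutative (Subgroup.closure {x, y}) := by
    refine Subgroup.isMulCommutative_closure ?_
    rintro a (rfl | rfl) b (rfl | rfl) <;> first | rfl | exact hy.eq | exact hy.eq.symm
  obtain ⟨M, hM, hmax⟩ := exists_maximal_isMulCommutative _ hab
  have hxM : x ∈ M := hM (Subgroup.subset_closure (by simp))
  have hyM : y ∈ M := hM (Subgroup.subset_closure (by simp))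
  -- Conjugation by `z` fixes `x ≠ 1` in `M`, so malnormality forces `z` into `M`.
  have hzM : z ∈ M := by
    by_contra h
    refine hx (hG M hmax z h x hxM ?_)
    rwa [hz.eq, mul_inv_cancel_right]
  have : IsMulCommutative M := hmax.1
  exact setLike_mul_comm hyM hzM

theorem IsCSA.commute_trans_of_mem {Γ : Type*} [Group Γ] {G : Subgroup Γ} (hG : IsCSA G)
    {x y z : Γ} (hxG : x ∈ G) (hyG : y ∈ G) (hzG : z ∈ G) (hx : x ≠ 1)
    (hy : Commute y x) (hz : Commute z x) : Commute y z := by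
  have := hG.commute_trans (x := ⟨x, hxG⟩) (y := ⟨y, hyG⟩) (z := ⟨z, hzG⟩)
    (by simpa using hx) (Subtype.ext hy.eq) (Subtype.ext hz.eq)
  exact congrArg Subtype.val this.eq

/-- The quotient by `G` is generated by the image of `t`, hence abelian. -/
theorem IsSuspension.commutator_mem {Γ : Type*} [Group Γ] {G : Subgroup Γ} {α : MulAut G} {t : Γ}
    (hs : IsSuspension G α t) (a b : Γ) : ⁅a, b⁆ ∈ G := by
  have := hs.normal
  have key : ∀ a : Γ, ∃ n : ℤ, (a : Γ ⧸ G) = (t : Γ ⧸ G) ^ n := by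
    intro a
    obtain ⟨⟨g, u⟩, rfl⟩ := hs.isComplement.2 a
    obtain ⟨n, hn⟩ := Subgroup.mem_zpowers_iff.1 u.2
    refine ⟨n, ?_⟩
    simp only [QuotientGroup.mk_mul, ← hn, (QuotientGroup.eq_one_iff (g : Γ)).2 g.2, one_mul,
      QuotientGroup.mk_zpow]
  obtain ⟨m, hm⟩ := key a
  obtain ⟨n, hn⟩ := key b
  rw [← QuotientGroup.eq_one_iff, ← QuotientGroup.mk'_apply, map_commutatorElement,
    QuotientGroup.mk'_apply, QuotientGroup.mk'_apply, hm, hn, commutatorElement_eq_one_iff_mul_comm]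
  exact (Commute.refl _).zpow_zpow m n

theorem IsSuspension.notMem {Γ : Type*} [Group Γ] {G : Subgroup Γ} {α : MulAut G} {t : Γ}
    (hs : IsSuspension G α t) : t ∉ G := by
  intro h
  have := Subgroup.disjoint_def.1 hs.isComplement.disjoint h (Subgroup.mem_zpowers t)
  exact hs.infinite_order (this ▸ IsOfFinOrder.one)

end CSA

/-! ### Black and white vertices; absence of leaves. -/

section Colours

variable {Γ : Type*} [Group Γ] {V : Type*} [MulAction Γ V] {T : SimpleGraph V}

theorem IsBlack.commute {b : V} (hb : IsBlack Γ b) {x y : Γ} (hx : x • b = b) (hy : y • b = b) :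
    Commute x y := by
  have : IsMulCommutative (MulAction.stabilizer Γ b) := hb
  exact setLike_mul_comm (s := MulAction.stabilizer Γ b) hx hy

theorem isBlack_iff {v : V} :
    IsBlack Γ v ↔ ∀ x y : Γ, x • v = v → y • v = v → Commute x y := by
  refine ⟨fun h x y => h.commute, fun h => ?_⟩
  unfold IsBlack
  rw [isMulCommutative_iff]
  exact fun x y => Subtype.ext (h x y x.2 y.2)

theorem isBlack_smul_iff (g : Γ) (v : V) : IsBlack Γ (g • v) ↔ IsBlack Γ v := by
  have key : ∀ (g : Γ) (v : V), IsBlack Γ v → IsBlack Γ (g • v) := by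
    intro g v h
    rw [isBlack_iff] at h ⊢
    intro x y hx hy
    have := h (g⁻¹ * x * g) (g⁻¹ * y * g) (by simp [mul_smul, hx]) (by simp [mul_smul, hy])
    have h2 := this.conj g
    simpa [mul_assoc] using h2
  exact ⟨fun h => by simpa using key g⁻¹ _ h, key g v⟩

theorem IsAbelianBipartite.not_isBlack (h : IsAbelianBipartite Γ T) {b v : V} (hb : IsBlack Γ b)
    (hbv : T.Adj b v) : ¬ IsBlack Γ v := (h b v hbv).1 hb

theorem IsAbelianBipartite.isBlack (h : IsAbelianBipartite Γ T) {v b : V} (hv : ¬ IsBlack Γ v)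
    (hvb : T.Adj v b) : IsBlack Γ b := by
  by_contra hb
  exact hv ((h v b hvb).2 hb)

/-- In a minimal tree no vertex has exactly one neighbour. -/
theorem IsMinimalTree.exists_adj_ne (hmin : IsMinimalTree Γ T) (hT : IsGroupTree Γ T)
    (hbip : IsAbelianBipartite Γ T) {x y : V} (hxy : T.Adj x y) : ∃ z, T.Adj x z ∧ z ≠ y := by
  by_contra! hx
  -- Pruning the orbit of a leaf `x` leaves a proper invariant subtree, nonempty because `y` has the
  -- other colour. It is connected since no geodesic has a leaf in its interior.
  let S : Set V := (MulAction.orbit Γ x)ᶜ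
  have hcolour : ∀ v ∈ MulAction.orbit Γ x, (IsBlack Γ v ↔ IsBlack Γ x) := by
    rintro _ ⟨g, rfl⟩
    exact isBlack_smul_iff g x
  have hy : y ∈ S := by
    intro hy
    have h1 := hcolour y hy
    have h2 := hbip x y hxy
    tauto
  have hleaf : ∀ g : Γ, ∀ z, T.Adj (g • x) z → z = g • y := by
    intro g z hz
    have h1 := hx (g⁻¹ • z) (by
      rw [← hT.adj_smul_iff g]
      simpa using hz)
    rw [← h1, smul_inv_smul]
  have hreach : ∀ (n : ℕ) (u : V) (hu : u ∈ S), T.dist y u = n →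
      (T.induce S).Reachable ⟨u, hu⟩ ⟨y, hy⟩ := by
    intro n
    induction n with
    | zero =>
      intro u hu h
      obtain rfl := hT.isTree.connected.dist_eq_zero_iff.1 h
      exact SimpleGraph.Reachable.refl _
    | succ n ih =>
      intro u hu h
      obtain ⟨w, huw, hw⟩ := exists_adj_dist_add_one hT.isTree.connected (r := y) (x := u) (by
        rintro rfl
        simp at h)
      have hwS : w ∈ S := by
        rintro ⟨g, rfl⟩
        simp only at huw hw
        by_cases hgy : g • x = y
        · exact hy ⟨g, hgy⟩
        obtain ⟨w', hw', hd⟩ := exists_adj_dist_add_one hT.isTree.connected hgy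
        have h1 := hleaf g w' hw'
        have h2 := hleaf g u huw.symm
        rw [h1, ← h2] at hd
        omega
      have hadj : (T.induce S).Adj ⟨u, hu⟩ ⟨w, hwS⟩ := huw
      exact hadj.reachable.trans (ih w hwS (by omega))
  have hS := hmin S ?_ ?_
  · have : x ∈ S := hS ▸ Set.mem_univ x
    exact this (MulAction.mem_orbit_self x)
  · have : Nonempty S := ⟨⟨y, hy⟩⟩
    exact ⟨fun u v => (hreach _ u u.2 rfl).trans (hreach _ v v.2 rfl).symm⟩
  · intro g v hv hgv
    exact hv (MulAction.mem_orbit_of_mem_orbit g⁻¹ hgv |> fun h => by simpa using h)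

end Colours

/-! ### Elements with nonabelian centralizer. -/

section Suspension

variable {Γ : Type*} [Group Γ] {G : Subgroup Γ} {α : MulAut G} {t : Γ} {V : Type*}
  [MulAction Γ V] {T : SimpleGraph V}

/-- A chosen generator `t_v ∈ G t` of the cyclic factor of the stabilizer of `v`. -/
noncomputable def IsPiecewiseTrivialSuspension.gen (hT : IsPiecewiseTrivialSuspension G t T)
    (v : V) : Γ := (hT.exists_central v).choose

namespace IsPiecewiseTrivialSuspension

theorem gen_mem (hT : IsPiecewiseTrivialSuspension G t T) (v : V) :
    ∃ g ∈ G, hT.gen v = g * t := (hT.exists_central v).choose_spec.1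

theorem gen_smul_eq_iff (hT : IsPiecewiseTrivialSuspension G t T) {v : V} (hv : ¬ IsBlack Γ v)
    {n : ℤ} (hn : n ≠ 0) (w : V) : hT.gen v ^ n • w = w ↔ T.dist v w ≤ 2 :=
  (hT.exists_central v).choose_spec.2.2 hv n hn w

theorem gen_smul (hT : IsPiecewiseTrivialSuspension G t T) {v : V} (hv : ¬ IsBlack Γ v)
    {w : V} (h : T.dist v w ≤ 2) : hT.gen v • w = w := by
  simpa using (hT.gen_smul_eq_iff hv one_ne_zero w).2 h

theorem dist_le_of_gen_smul (hT : IsPiecewiseTrivialSuspension G t T) {v : V}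
    (hv : ¬ IsBlack Γ v) {w : V} (h : hT.gen v • w = w) : T.dist v w ≤ 2 :=
  (hT.gen_smul_eq_iff hv one_ne_zero w).1 (by simpa using h)

theorem gen_mul_inv_mem (hT : IsPiecewiseTrivialSuspension G t T) (v w : V) :
    hT.gen v * (hT.gen w)⁻¹ ∈ G := by
  obtain ⟨g, hg, h⟩ := hT.gen_mem v
  obtain ⟨g', hg', h'⟩ := hT.gen_mem w
  rw [h, h', mul_inv_rev, mul_assoc, mul_inv_cancel_left]
  exact G.mul_mem hg (G.inv_mem hg')

theorem exists_eq_mul_gen_zpow (hT : IsPiecewiseTrivialSuspension G t T) {v : V} {x : Γ}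
    (hx : x • v = v) : ∃ g ∈ G, g • v = v ∧ ∃ n : ℤ, x = g * hT.gen v ^ n := by
  have hd := (hT.exists_central v).choose_spec.2.1
  change IsInternalDirectProduct _ _ (Subgroup.zpowers (hT.gen v)) at hd
  have hx' : x ∈ (MulAction.stabilizer Γ v ⊓ G) ⊔ Subgroup.zpowers (hT.gen v) := by
    rw [hd.sup_eq]; exact hx
  have hc : ∀ g ∈ G, g • v = v → ∀ n : ℤ, Commute g (hT.gen v ^ n) := fun g hg hgv n =>
    hd.comm g ⟨hgv, hg⟩ _ (Subgroup.zpow_mem _ (Subgroup.mem_zpowers _) n)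
  rw [Subgroup.sup_eq_closure] at hx'
  clear hx
  induction hx' using Subgroup.closure_induction with
  | mem y hy =>
    rcases hy with hy | hy
    · exact ⟨y, hy.2, hy.1, 0, by simp⟩
    · obtain ⟨n, rfl⟩ := Subgroup.mem_zpowers_iff.1 hy
      exact ⟨1, G.one_mem, by simp, n, by simp⟩
  | one => exact ⟨1, G.one_mem, by simp, 0, by simp⟩
  | mul y z _ _ ihy ihz =>
    obtain ⟨g, hg, hgv, n, rfl⟩ := ihy
    obtain ⟨k, hk, hkv, m, rfl⟩ := ihz
    refine ⟨g * k, G.mul_mem hg hk, by rw [mul_smul, hkv, hgv], n + m, ?_⟩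
    rw [zpow_add, mul_assoc, ← mul_assoc _ k, ← (hc k hk hkv n).eq]
    simp only [mul_assoc]
  | inv y _ ih =>
    obtain ⟨g, hg, hgv, n, rfl⟩ := ih
    refine ⟨g⁻¹, G.inv_mem hg, by rw [inv_smul_eq_iff, hgv], -n, ?_⟩
    rw [(hc g hg hgv n).eq, mul_inv_rev, zpow_neg]

theorem commute_gen (hT : IsPiecewiseTrivialSuspension G t T) {v : V} {x : Γ}
    (hx : x • v = v) : Commute x (hT.gen v) := by
  have hd := (hT.exists_central v).choose_spec.2.1
  obtain ⟨g, hg, hgv, n, rfl⟩ := hT.exists_eq_mul_gen_zpow hx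
  exact Commute.mul_left (hd.comm g ⟨hgv, hg⟩ _ (Subgroup.mem_zpowers _))
    ((Commute.refl _).zpow_left n)

/-- Distinct white vertices have distinct balls of radius `2`. -/
theorem eq_of_ball_eq (hT : IsPiecewiseTrivialSuspension G t T) (hmin : IsMinimalTree Γ T)
    {v w : V} (hv : ¬ IsBlack Γ v) (hw : ¬ IsBlack Γ w)
    (h : ∀ x, T.dist v x ≤ 2 ↔ T.dist w x ≤ 2) : v = w := by
  by_contra hvw
  have htree := hT.isGroupTree.isTree
  obtain ⟨b, hvb, hb⟩ := exists_adj_dist_add_one htree.connected (r := w) hvw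
  -- The neighbour `c` of `v` points away from `w`. Lying in the ball around `w`, it forces `v` and
  -- `w` to be adjacent, although both are white.
  obtain ⟨c, hvc, hcb⟩ := hmin.exists_adj_ne hT.isGroupTree hT.bipartite hvb
  have h1 := dist_add_one_of_adj htree hvb hvc (r := w) (by omega) hcb.symm
  have h2 := (h c).1 (by rw [SimpleGraph.dist_eq_one_iff_adj.2 hvc]; omega)
  have h3 : T.Adj w v := by
    rw [← SimpleGraph.dist_eq_one_iff_adj]
    omega
  exact hv (hT.bipartite.isBlack hw h3)

/-- The centralizer of a nontrivial power of `t_v` is the stabilizer of `v`. -/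
theorem commute_gen_zpow_iff (hT : IsPiecewiseTrivialSuspension G t T) (hmin : IsMinimalTree Γ T)
    {v : V} (hv : ¬ IsBlack Γ v) {n : ℤ} (hn : n ≠ 0) {z : Γ} :
    Commute z (hT.gen v ^ n) ↔ z • v = v := by
  refine ⟨fun hz => ?_, fun hz => (hT.commute_gen hz).zpow_right n⟩
  refine hT.eq_of_ball_eq hmin (by rwa [isBlack_smul_iff]) hv fun x => ?_
  obtain ⟨y, rfl⟩ := MulAction.surjective z x
  rw [hT.isGroupTree.dist_smul, ← hT.gen_smul_eq_iff hv hn, ← hT.gen_smul_eq_iff hv hn,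
    ← mul_smul _ z, ← hz.eq, mul_smul, smul_left_cancel_iff]

/-- An element of `G` that fixes two edges at a white vertex is trivial. -/
theorem eq_one_of_fix_two_edges (hT : IsPiecewiseTrivialSuspension G t T)
    (hmin : IsMinimalTree Γ T) (hG : IsCSA G) {v b c : V} (hv : ¬ IsBlack Γ v)
    (hvb : T.Adj v b) (hvc : T.Adj v c) (hbc : b ≠ c) {x : Γ} (hx : x ∈ G)
    (hxb : x • b = b) (hxc : x • c = c) : x = 1 := by
  by_contra hne
  have htree := hT.isGroupTree.isTree
  -- Beyond `b` lies another white `w`. Both `t_w` and `t_v` fix `b`, so they commute with each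
  -- other and with `x`; their quotient lies in `G`, where the CSA property applies.
  have key : ∀ b, T.Adj v b → x • b = b → ∃ w, T.Adj b w ∧ w ≠ v ∧ ¬ IsBlack Γ w ∧
      Commute (hT.gen w) (hT.gen v) ∧ Commute (hT.gen w * (hT.gen v)⁻¹) x := by
    intro b hvb hxb
    obtain ⟨w, hbw, hwv⟩ := hmin.exists_adj_ne hT.isGroupTree hT.bipartite hvb.symm
    have hb := hT.bipartite.isBlack hv hvb
    have hw := hT.bipartite.not_isBlack hb hbw
    have h1 : hT.gen w • b = b := hT.gen_smul hw (by
      rw [SimpleGraph.dist_eq_one_iff_adj.2 hbw.symm]; omega)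
    have h2 : hT.gen v • b = b := hT.gen_smul hv (by
      rw [SimpleGraph.dist_eq_one_iff_adj.2 hvb]; omega)
    exact ⟨w, hbw, hwv, hw, hb.commute h1 h2,
      (hb.commute h1 hxb).mul_left (hb.commute h2 hxb).inv_left⟩
  obtain ⟨w, hbw, hwv, hw, h1, h2⟩ := key b hvb hxb
  obtain ⟨u, hcu, huv, hu, h3, h4⟩ := key c hvc hxc
  have h5 := hG.commute_trans_of_mem hx (hT.gen_mul_inv_mem w v) (hT.gen_mul_inv_mem u v) hne h2 h4
  have h6 : Commute (hT.gen w) (hT.gen u) := by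
    have e1 : hT.gen w = hT.gen w * (hT.gen v)⁻¹ * hT.gen v := by group
    have e2 : hT.gen u = hT.gen u * (hT.gen v)⁻¹ * hT.gen v := by group
    rw [e1, e2]
    have h7 : Commute (hT.gen w * (hT.gen v)⁻¹) (hT.gen v) :=
      h1.mul_left (Commute.refl _).inv_left
    have h8 : Commute (hT.gen v) (hT.gen u * (hT.gen v)⁻¹) :=
      (h3.mul_left (Commute.refl _).inv_left).symm
    exact (h5.mul_right h7).mul_left (h8.mul_right (Commute.refl _))
  have h7 : hT.gen u • w = w := by
    have := hT.commute_gen_zpow_iff hmin hw one_ne_zero (z := hT.gen u)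
    rw [zpow_one] at this
    exact this.1 h6.symm
  -- The path `w, b, v, c, u` has length 4, but `t_u` fixes only the ball of radius 2 around `u`.
  have h8 := hT.dist_le_of_gen_smul hu h7
  have d1 : T.dist w v = 2 := dist_eq_two htree hbw hvb.symm hwv
  have d0 : T.dist w b = 1 := SimpleGraph.dist_eq_one_iff_adj.2 hbw.symm
  have d2 := dist_add_one_of_adj htree hvb hvc (r := w) (by omega) hbc
  have d3 := dist_add_one_of_adj htree hvc.symm hcu (r := w) (by omega) huv.symm
  rw [T.dist_comm] at h8
  omega

/-- A nontrivial element of `G` does not fix two vertices at distance at least `3`. -/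
theorem eq_one_of_fix_far (hT : IsPiecewiseTrivialSuspension G t T)
    (hmin : IsMinimalTree Γ T) (hG : IsCSA G) {x : Γ} (hx : x ∈ G) {p q : V}
    (hpq : 3 ≤ T.dist p q) (hp : x • p = p) (hq : x • q = q) : x = 1 := by
  have htree := hT.isGroupTree.isTree
  have step : ∀ y, x • y = y → 0 < T.dist q y →
      ∃ z, T.Adj y z ∧ T.dist q z + 1 = T.dist q y ∧ x • z = z := by
    intro y hy hqy
    obtain ⟨z, hyz, hz⟩ := exists_adj_dist_add_one htree.connected (r := q) (x := y) (by
      rintro rfl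
      simp at hqy)
    exact ⟨z, hyz, hz, hT.isGroupTree.smul_eq_of_closer hy hq hyz (by omega)⟩
  rw [T.dist_comm] at hpq
  obtain ⟨a, hpa, da, ha⟩ := step p hp (by omega)
  obtain ⟨b, hab, db, hb⟩ := step a ha (by omega)
  obtain ⟨c, hbc, dc, hc⟩ := step b hb (by omega)
  -- Of the interior vertices `a`, `b` of three consecutive fixed edges, one is white.
  by_cases hblack : IsBlack Γ a
  · exact hT.eq_one_of_fix_two_edges hmin hG (hT.bipartite.not_isBlack hblack hab) hab.symm hbc
      (by rintro rfl; omega) hx ha hc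
  · exact hT.eq_one_of_fix_two_edges hmin hG hblack hpa.symm hab
      (by rintro rfl; omega) hx hp hb

/-- A nontrivial element with nonabelian centralizer is a power of some `t_v` with `v` white. -/
theorem exists_eq_gen_zpow (hT : IsPiecewiseTrivialSuspension G t T)
    (hmin : IsMinimalTree Γ T) (hG : IsCSA G) (hs : IsSuspension G α t) {x : Γ} (hx : x ≠ 1)
    {a b : Γ} (ha : Commute a x) (hb : Commute b x) (hab : ¬ Commute a b) :
    ∃ v : V, ¬ IsBlack Γ v ∧ ∃ n : ℤ, n ≠ 0 ∧ x = hT.gen v ^ n := by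
  have htree := hT.isGroupTree.isTree
  have hpow : ∀ {v : V}, ¬ IsBlack Γ v → ∀ n : ℤ, x = hT.gen v ^ n →
      ∃ v : V, ¬ IsBlack Γ v ∧ ∃ n : ℤ, n ≠ 0 ∧ x = hT.gen v ^ n := by
    intro v hv n h
    refine ⟨v, hv, n, ?_, h⟩
    rintro rfl
    exact hx (by simpa using h)
  have hmove : ∀ {z : Γ}, Commute z x → ∀ {v : V}, x • v = v → x • z • v = z • v := by
    intro z hz v hv
    rw [← mul_smul, ← hz.eq, mul_smul, hv]
  by_cases hell : ∃ u : V, x • u = u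
  swap
  · push Not at hell
    obtain ⟨p, q, hpq, hp, hq⟩ := hT.isGroupTree.exists_commutator_fix hell ha hb
    exact absurd (commutatorElement_eq_one_iff_commute.1
      (hT.eq_one_of_fix_far hmin hG (hs.commutator_mem a b) hpq hp hq)) hab
  by_contra hcon
  -- Write `x = g t_v^n`. Since `t_v` fixes every edge at `v`, two edges fixed by `x` are fixed by
  -- `g` too, so `g = 1`, which is excluded.
  have hvalence : ∀ {v c d : V}, ¬ IsBlack Γ v → x • v = v → T.Adj v c → T.Adj v d →
      x • c = c → x • d = d → c = d := by
    intro v c d hv hxv hvc hvd hc hd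
    by_contra hcd
    obtain ⟨g, hg, hgv, n, rfl⟩ := hT.exists_eq_mul_gen_zpow hxv
    have hfix : ∀ w, T.Adj v w → (g * hT.gen v ^ n) • w = w → g • w = w := by
      intro w hvw hw
      have h1 : hT.gen v ∈ MulAction.stabilizer Γ w := hT.gen_smul hv (by
        rw [SimpleGraph.dist_eq_one_iff_adj.2 hvw]; omega)
      have h2 : hT.gen v ^ n • w = w := Subgroup.zpow_mem _ h1 n
      rwa [mul_smul, h2] at hw
    have := hT.eq_one_of_fix_two_edges hmin hG hv hvc hvd hcd hg (hfix c hvc hc) (hfix d hvd hd)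
    exact hcon (hpow hv n (by rw [this, one_mul]))
  by_cases hblack : ∃ c : V, IsBlack Γ c ∧ x • c = c
  · obtain ⟨c, hc, hxc⟩ := hblack
    -- Otherwise `x` fixes the geodesic from `c` to `z • c`, which passes through a white vertex
    -- along two distinct fixed edges.
    have hfix : ∀ z, Commute z x → z • c = c := by
      intro z hz
      by_contra hzc
      have hxz := hmove hz hxc
      obtain ⟨v, hcv, hd⟩ := exists_adj_dist_add_one htree.connected (r := z • c) (Ne.symm hzc)
      have hv := hT.bipartite.not_isBlack hc hcv
      have hxv := hT.isGroupTree.smul_eq_of_closer hxc hxz hcv (by omega)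
      obtain ⟨d, hvd, hd'⟩ := exists_adj_dist_add_one htree.connected (r := z • c) (x := v) (by
        rintro rfl
        exact hv ((isBlack_smul_iff z c).2 hc))
      have hxd := hT.isGroupTree.smul_eq_of_closer hxv hxz hvd (by omega)
      have := hvalence hv hxv hcv.symm hvd hxc hxd
      subst this
      omega
    exact hab (hc.commute (hfix a ha) (hfix b hb))
  · push Not at hblack
    obtain ⟨v, hxv⟩ := hell
    have hv : ¬ IsBlack Γ v := fun h => hblack v h hxv
    have hfix : ∀ z, Commute z x → z • v = v := by
      intro z hz
      by_contra hzv
      have hxz := hmove hz hxv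
      obtain ⟨c, hvc, hd⟩ := exists_adj_dist_add_one htree.connected (r := z • v) (Ne.symm hzv)
      exact hblack c (hT.bipartite.isBlack hv hvc)
        (hT.isGroupTree.smul_eq_of_closer hxv hxz hvc (by omega))
    obtain ⟨g, hg, hgv, n, hxg⟩ := hT.exists_eq_mul_gen_zpow hxv
    by_cases hg1 : g = 1
    · exact hcon (hpow hv n (by rw [hxg, hg1, one_mul]))
    -- As `t_v` is central in the stabilizer of `v`, commuting with `x` amounts to the `G`-component
    -- commuting with `g ≠ 1`; commutation is then transitive.
    have key : ∀ z, Commute z x → ∃ k ∈ G, k • v = v ∧ Commute k g ∧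
        ∃ m : ℤ, z = k * hT.gen v ^ m := by
      intro z hz
      have hzv := hfix z hz
      obtain ⟨k, hk, hkv, m, hzk⟩ := hT.exists_eq_mul_gen_zpow hzv
      refine ⟨k, hk, hkv, ?_, m, hzk⟩
      have h1 : g = x * (hT.gen v ^ n)⁻¹ := by rw [hxg]; group
      have h2 : k = z * (hT.gen v ^ m)⁻¹ := by rw [hzk]; group
      have h3 : Commute z g := by
        rw [h1]
        exact hz.mul_right ((hT.commute_gen hzv).zpow_right n).inv_right
      rw [h2]
      exact h3.mul_left ((hT.commute_gen hgv).zpow_right m).inv_right.symm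
    obtain ⟨k, hk, hkv, hkg, m, rfl⟩ := key a ha
    obtain ⟨k', hk', hkv', hkg', m', rfl⟩ := key b hb
    have h1 := hG.commute_trans_of_mem hg hk hk' hg1 hkg hkg'
    have h2 := (hT.commute_gen hkv).zpow_right m'
    have h3 := ((hT.commute_gen hkv').zpow_right m).symm
    exact hab ((h1.mul_right h2).mul_left (h3.mul_right ((Commute.refl _).zpow_zpow m m')))

end IsPiecewiseTrivialSuspension

end Suspension

/-! ### Matching the two trees. -/

section Comparison

variable {Γ : Type*} [Group Γ] {G G' : Subgroup Γ} {α : MulAut G} {α' : MulAut G'} {t t' : Γ}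
  {V V' : Type*} [MulAction Γ V] [MulAction Γ V'] {T : SimpleGraph V} {T' : SimpleGraph V'}

namespace IsPiecewiseTrivialSuspension

theorem gen_ne_one (hT : IsPiecewiseTrivialSuspension G t T) (hs : IsSuspension G α t) (v : V) :
    hT.gen v ≠ 1 := by
  intro h
  obtain ⟨g, hg, h'⟩ := hT.gen_mem v
  rw [h] at h'
  rw [eq_inv_of_mul_eq_one_right h'.symm] at hs
  exact hs.notMem (G.inv_mem hg)

/-- The stabilizer of a white vertex fixes no other white vertex. -/
theorem eq_of_stabilizer_le (hT : IsPiecewiseTrivialSuspension G t T) {v w : V}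
    (hv : ¬ IsBlack Γ v) (h : ∀ g : Γ, g • v = v → g • w = w) : v = w := by
  by_contra hvw
  -- Otherwise the stabilizer of `v` fixes the black vertex next to `v` on the way to `w`, hence is
  -- abelian.
  obtain ⟨b, hvb, hb⟩ := exists_adj_dist_add_one hT.isGroupTree.isTree.connected (r := w) hvw
  have hfix : ∀ g : Γ, g • v = v → g • b = b := fun g hg =>
    hT.isGroupTree.smul_eq_of_closer hg (h g hg) hvb (by omega)
  have hblack := hT.bipartite.isBlack hv hvb
  exact hv (isBlack_iff.2 fun x y hx hy => hblack.commute (hfix x hx) (hfix y hy))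

/-- If the stabilizer of the white vertex `v` is the centralizer of `x ≠ 1`, then `x` is a power
of `t_v`. -/
theorem eq_gen_zpow_of_centralizer (hT : IsPiecewiseTrivialSuspension G t T)
    (hmin : IsMinimalTree Γ T) (hG : IsCSA G) (hs : IsSuspension G α t) {v : V}
    (hv : ¬ IsBlack Γ v) {x : Γ} (hx : x ≠ 1) (hxv : ∀ g : Γ, Commute g x ↔ g • v = v) :
    ∃ n : ℤ, n ≠ 0 ∧ x = hT.gen v ^ n := by
  have hnc := hv
  rw [isBlack_iff] at hnc
  push Not at hnc
  obtain ⟨a, b, ha, hb, hab⟩ := hnc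
  obtain ⟨w, hw, n, hn, rfl⟩ := hT.exists_eq_gen_zpow hmin hG hs hx ((hxv a).2 ha) ((hxv b).2 hb) hab
  have : w = v := hT.eq_of_stabilizer_le hw fun g hg =>
    (hxv g).1 ((hT.commute_gen_zpow_iff hmin hw hn).2 hg)
  subst this
  exact ⟨n, hn, rfl⟩

/-- Group theoretic description of the relation of being at distance at most `2` on the set of
white vertices. -/
theorem dist_le_two_iff (hT : IsPiecewiseTrivialSuspension G t T)
    (hmin : IsMinimalTree Γ T) (hG : IsCSA G) (hs : IsSuspension G α t) {v w : V}
    (hv : ¬ IsBlack Γ v) :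
    T.dist v w ≤ 2 ↔ ∃ x : Γ, x ≠ 1 ∧ (∀ g : Γ, Commute g x ↔ g • v = v) ∧ x • w = w := by
  constructor
  · intro h
    refine ⟨hT.gen v, hT.gen_ne_one hs v, fun g => ?_, hT.gen_smul hv h⟩
    have := hT.commute_gen_zpow_iff hmin hv one_ne_zero (z := g)
    rwa [zpow_one] at this
  · rintro ⟨x, hx, hxv, hxw⟩
    obtain ⟨n, hn, rfl⟩ := hT.eq_gen_zpow_of_centralizer hmin hG hs hv hx hxv
    exact (hT.gen_smul_eq_iff hv hn w).1 hxw

/-- Every white vertex stabilizer of one tree is a white vertex stabilizer of the other. -/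
theorem exists_stabilizer_eq (hT : IsPiecewiseTrivialSuspension G t T)
    (hT' : IsPiecewiseTrivialSuspension G' t' T') (hmin : IsMinimalTree Γ T)
    (hmin' : IsMinimalTree Γ T') (hG' : IsCSA G') (hs : IsSuspension G α t)
    (hs' : IsSuspension G' α' t') {v : V} (hv : ¬ IsBlack Γ v) :
    ∃ w : V', MulAction.stabilizer Γ v = MulAction.stabilizer Γ w := by
  have hnc := hv
  rw [isBlack_iff] at hnc
  push Not at hnc
  obtain ⟨a, b, ha, hb, hab⟩ := hnc
  obtain ⟨w, hw, n, hn, h⟩ := hT'.exists_eq_gen_zpow hmin' hG' hs' (hT.gen_ne_one hs v)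
    (hT.commute_gen ha) (hT.commute_gen hb) hab
  refine ⟨w, ?_⟩
  ext g
  have h1 := hT.commute_gen_zpow_iff hmin hv one_ne_zero (z := g)
  rw [zpow_one, h, hT'.commute_gen_zpow_iff hmin' hw hn] at h1
  exact h1.symm

/-- A white vertex at distance at most `2` from two neighbours of `b` is a neighbour of `b`. -/
theorem adj_of_dist_le_two (hT : IsPiecewiseTrivialSuspension G t T) {b u v w : V}
    (hb : IsBlack Γ b) (hu : T.Adj b u) (hv : T.Adj b v) (huv : u ≠ v) (hw : ¬ IsBlack Γ w)
    (h1 : T.dist u w ≤ 2) (h2 : T.dist v w ≤ 2) : T.Adj b w := by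
  have htree := hT.isGroupTree.isTree
  rw [T.dist_comm] at h1 h2
  have h3 := htree.dist_eq_dist_add_one_of_adj w hu
  have h4 := htree.dist_eq_dist_add_one_of_adj w hv
  -- Farther out, both `u` and `v` would be nearer to `w` than `b` is, but only one neighbour of `b`
  -- can be.
  have h5 : T.dist w b ≤ 1 := by
    by_contra h
    exact huv (eq_of_adj_of_dist_lt (r := w) htree hu hv (by omega) (by omega))
  have h6 : w ≠ b := by
    rintro rfl
    exact hw hb
  have h7 := htree.connected.pos_dist_of_ne h6
  exact (SimpleGraph.dist_eq_one_iff_adj.1 (by omega : T.dist w b = 1)).symm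

theorem exists_adj_of_isBlack (hT : IsPiecewiseTrivialSuspension G t T)
    (hΓ : ∃ x y : Γ, ¬ Commute x y) {b : V} (hb : IsBlack Γ b) : ∃ v, T.Adj b v := by
  by_contra! h
  obtain ⟨x, y, hxy⟩ := hΓ
  have hfix : ∀ g : Γ, g • b = b := by
    intro g
    by_contra hg
    obtain ⟨v, hv, -⟩ := exists_adj_dist_add_one hT.isGroupTree.isTree.connected
      (r := g • b) (Ne.symm hg)
    exact h v hv
  exact hxy (hb.commute (hfix x) (hfix y))

theorem subsingleton_of_comm (hT : IsPiecewiseTrivialSuspension G t T)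
    (hΓ : ∀ x y : Γ, Commute x y) : Subsingleton V := by
  refine ⟨fun v w => ?_⟩
  by_contra hvw
  obtain ⟨u, hu, -⟩ := exists_adj_dist_add_one hT.isGroupTree.isTree.connected hvw
  have hblack : ∀ v : V, IsBlack Γ v := fun v => isBlack_iff.2 fun x y _ _ => hΓ x y
  exact hT.bipartite.not_isBlack (hblack v) hu (hblack u)

end IsPiecewiseTrivialSuspension

/-- Vertices `v` of `T` and `w` of `T'` correspond to each other: either both are white with the
same stabilizer, or both are black and their neighbours correspond to each other. -/
def Corresponds (T : SimpleGraph V) (T' : SimpleGraph V') (Γ : Type*) [Group Γ] [MulAction Γ V]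
    [MulAction Γ V'] (v : V) (w : V') : Prop :=
  (¬ IsBlack Γ v ∧ MulAction.stabilizer Γ v = MulAction.stabilizer Γ w) ∨
    (IsBlack Γ v ∧ IsBlack Γ w ∧ ∀ (x : V) (y : V'), ¬ IsBlack Γ x →
      MulAction.stabilizer Γ x = MulAction.stabilizer Γ y → (T.Adj v x ↔ T'.Adj w y))

theorem isBlack_congr {v : V} {w : V'}
    (h : MulAction.stabilizer Γ v = MulAction.stabilizer Γ w) : IsBlack Γ v ↔ IsBlack Γ w := by
  unfold IsBlack
  rw [h]

theorem Corresponds.symm {v : V} {w : V'} (h : Corresponds T T' Γ v w) :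
    Corresponds T' T Γ w v := by
  rcases h with ⟨h1, h2⟩ | ⟨h1, h2, h3⟩
  · exact Or.inl ⟨by rwa [← isBlack_congr h2], h2.symm⟩
  · exact Or.inr ⟨h2, h1, fun x y hx hxy =>
      (h3 y x (by rwa [isBlack_congr hxy.symm]) hxy.symm).symm⟩

theorem stabilizer_smul_eq_iff (g : Γ) (v : V) (w : V') :
    MulAction.stabilizer Γ (g • v) = MulAction.stabilizer Γ (g • w) ↔
      MulAction.stabilizer Γ v = MulAction.stabilizer Γ w := by
  rw [MulAction.stabilizer_smul_eq_stabilizer_map_conj,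
    MulAction.stabilizer_smul_eq_stabilizer_map_conj]
  exact (Subgroup.map_injective (MulAut.conj g).injective).eq_iff

theorem Corresponds.smul (hT : IsGroupTree Γ T) (hT' : IsGroupTree Γ T') {v : V} {w : V'}
    (h : Corresponds T T' Γ v w) (g : Γ) : Corresponds T T' Γ (g • v) (g • w) := by
  rcases h with ⟨h1, h2⟩ | ⟨h1, h2, h3⟩
  · exact Or.inl ⟨by rwa [isBlack_smul_iff], (stabilizer_smul_eq_iff g v w).2 h2⟩
  · refine Or.inr ⟨(isBlack_smul_iff g v).2 h1, (isBlack_smul_iff g w).2 h2, fun x y hx hxy => ?_⟩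
    have := h3 (g⁻¹ • x) (g⁻¹ • y) (by rwa [isBlack_smul_iff])
      ((stabilizer_smul_eq_iff g⁻¹ x y).2 hxy)
    rwa [← hT.adj_smul_iff g, ← hT'.adj_smul_iff g, smul_inv_smul, smul_inv_smul] at this

/-- Every edge has exactly one black end, whose clause in `Corresponds` transports adjacency to the
white end. -/
theorem Corresponds.adj (hT : IsAbelianBipartite Γ T) {v x : V} {w y : V'}
    (h : Corresponds T T' Γ v w) (h' : Corresponds T T' Γ x y) (hvx : T.Adj v x) :
    T'.Adj w y := by
  rcases h with ⟨h1, h2⟩ | ⟨h1, h2, h3⟩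
  · rcases h' with ⟨h1', -⟩ | ⟨h1', h2', h3'⟩
    · exact absurd (hT.isBlack h1 hvx) h1'
    · exact ((h3' v w h1 h2).1 hvx.symm).symm
  · rcases h' with ⟨h1', h2'⟩ | ⟨h1', -⟩
    · exact (h3 x y h1' h2').1 hvx
    · exact absurd h1' (hT.not_isBlack h1 hvx)

namespace IsPiecewiseTrivialSuspension

theorem dist_le_two_congr (hT : IsPiecewiseTrivialSuspension G t T)
    (hT' : IsPiecewiseTrivialSuspension G' t' T') (hmin : IsMinimalTree Γ T)
    (hmin' : IsMinimalTree Γ T') (hG : IsCSA G) (hG' : IsCSA G') (hs : IsSuspension G α t)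
    (hs' : IsSuspension G' α' t') {v x : V} {w y : V'} (hv : ¬ IsBlack Γ v)
    (hvw : MulAction.stabilizer Γ v = MulAction.stabilizer Γ w)
    (hxy : MulAction.stabilizer Γ x = MulAction.stabilizer Γ y) :
    T.dist v x ≤ 2 ↔ T'.dist w y ≤ 2 := by
  rw [hT.dist_le_two_iff hmin hG hs hv,
    hT'.dist_le_two_iff hmin' hG' hs' (by rwa [← isBlack_congr hvw])]
  simp only [← MulAction.mem_stabilizer_iff, hvw, hxy]

/-- For black `v`, take two neighbours; their white counterparts are distinct and at distance 2, and
the partner of `v` is the midpoint. Adjacency to it means distance at most 2 from both counterparts.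
-/
theorem exists_corresponds (hT : IsPiecewiseTrivialSuspension G t T)
    (hT' : IsPiecewiseTrivialSuspension G' t' T') (hmin : IsMinimalTree Γ T)
    (hmin' : IsMinimalTree Γ T') (hG : IsCSA G) (hG' : IsCSA G') (hs : IsSuspension G α t)
    (hs' : IsSuspension G' α' t') (hΓ : ∃ x y : Γ, ¬ Commute x y) (v : V) :
    ∃ w : V', Corresponds T T' Γ v w := by
  by_cases hv : IsBlack Γ v
  swap
  · obtain ⟨w, hw⟩ := hT.exists_stabilizer_eq hT' hmin hmin' hG' hs hs' hv
    exact ⟨w, Or.inl ⟨hv, hw⟩⟩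
  obtain ⟨x, hvx⟩ := hT.exists_adj_of_isBlack hΓ hv
  obtain ⟨y, hvy, hyx⟩ := hmin.exists_adj_ne hT.isGroupTree hT.bipartite hvx
  have hx := hT.bipartite.not_isBlack hv hvx
  have hy := hT.bipartite.not_isBlack hv hvy
  obtain ⟨x', hxx'⟩ := hT.exists_stabilizer_eq hT' hmin hmin' hG' hs hs' hx
  obtain ⟨y', hyy'⟩ := hT.exists_stabilizer_eq hT' hmin hmin' hG' hs hs' hy
  have hx' : ¬ IsBlack Γ x' := by rwa [← isBlack_congr hxx']
  have hy' : ¬ IsBlack Γ y' := by rwa [← isBlack_congr hyy']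
  have hne : y' ≠ x' := by
    rintro rfl
    refine hyx (hT.eq_of_stabilizer_le hy fun g hg => ?_)
    rw [← MulAction.mem_stabilizer_iff, hyy', ← hxx'] at hg
    exact hg
  have hdist : ∀ {a c : V} {a' c' : V'}, ¬ IsBlack Γ a →
      MulAction.stabilizer Γ a = MulAction.stabilizer Γ a' →
      MulAction.stabilizer Γ c = MulAction.stabilizer Γ c' →
      (T.dist a c ≤ 2 ↔ T'.dist a' c' ≤ 2) := fun ha h h' =>
    hT.dist_le_two_congr hT' hmin hmin' hG hG' hs hs' ha h h'
  have htree := hT.isGroupTree.isTree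
  have htree' := hT'.isGroupTree.isTree
  have hd : T'.dist x' y' ≤ 2 :=
    (hdist hx hxx' hyy').1 (dist_eq_two htree hvx hvy hyx.symm).le
  obtain ⟨w, hyw, hdw⟩ := exists_adj_dist_add_one htree'.connected (r := x') hne
  have hw : IsBlack Γ w := hT'.bipartite.isBlack hy' hyw
  have hxw : T'.Adj x' w := by
    have : x' ≠ w := by
      rintro rfl
      exact hx' hw
    have := htree'.connected.pos_dist_of_ne this
    exact SimpleGraph.dist_eq_one_iff_adj.1 (by omega)
  refine ⟨w, Or.inr ⟨hv, hw, fun a a' ha haa' => ⟨fun h => ?_, fun h => ?_⟩⟩⟩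
  · have hle : ∀ c, T.Adj v c → T.dist c a ≤ 2 := by
      intro c hc
      by_cases hca : c = a
      · simp [hca]
      · exact (dist_eq_two htree hc h hca).le
    exact hT'.adj_of_dist_le_two hw hxw.symm hyw.symm hne.symm (by rwa [← isBlack_congr haa'])
      ((hdist hx hxx' haa').1 (hle x hvx)) ((hdist hy hyy' haa').1 (hle y hvy))
  · have hle : ∀ c, T'.Adj w c → T'.dist c a' ≤ 2 := by
      intro c hc
      by_cases hca : c = a'
      · simp [hca]
      · exact (dist_eq_two htree' hc h hca).le
    exact hT.adj_of_dist_le_two hv hvx hvy hyx.symm ha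
      ((hdist hx hxx' haa').2 (hle x' hxw.symm)) ((hdist hy hyy' haa').2 (hle y' hyw.symm))

/-- Two black partners have the same neighbours, at least two of them, and distinct vertices with
two common neighbours would create a cycle. -/
theorem eq_of_corresponds (hT : IsPiecewiseTrivialSuspension G t T)
    (hT' : IsPiecewiseTrivialSuspension G' t' T') (hmin : IsMinimalTree Γ T)
    (hmin' : IsMinimalTree Γ T') (hG : IsCSA G) (hs : IsSuspension G α t)
    (hs' : IsSuspension G' α' t') (hΓ : ∃ x y : Γ, ¬ Commute x y) {v : V} {w w' : V'}
    (h : Corresponds T T' Γ v w) (h' : Corresponds T T' Γ v w') : w = w' := by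
  rcases h with ⟨h1, h2⟩ | ⟨h1, h2, h3⟩
  · rcases h' with ⟨-, h2'⟩ | ⟨h1', -⟩
    · refine hT'.eq_of_stabilizer_le (by rwa [← isBlack_congr h2]) fun g hg => ?_
      rw [← MulAction.mem_stabilizer_iff, ← h2, h2'] at hg
      exact hg
    · exact absurd h1' h1
  · rcases h' with ⟨h1', -⟩ | ⟨-, h2', h3'⟩
    · exact absurd h1 h1'
    obtain ⟨x, hwx⟩ := hT'.exists_adj_of_isBlack hΓ h2
    obtain ⟨y, hwy, hyx⟩ := hmin'.exists_adj_ne hT'.isGroupTree hT'.bipartite hwx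
    have key : ∀ x, T'.Adj w x → T'.Adj w' x := by
      intro x hx
      have hxw := hT'.bipartite.not_isBlack h2 hx
      obtain ⟨z, hz⟩ := hT'.exists_stabilizer_eq hT hmin' hmin hG hs' hs hxw
      have hzw : ¬ IsBlack Γ z := by rwa [← isBlack_congr hz]
      exact (h3' z x hzw hz.symm).1 ((h3 z x hzw hz.symm).2 hx)
    have htree := hT'.isGroupTree.isTree
    have hd := dist_eq_two htree hwx hwy hyx.symm
    refine eq_of_adj_of_dist_lt (r := x) htree hwy.symm (key y hwy).symm ?_ ?_ <;>
      rw [hd, SimpleGraph.dist_eq_one_iff_adj.2]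
    · omega
    · exact hwx.symm
    · omega
    · exact (key x hwx).symm

end IsPiecewiseTrivialSuspension

end Comparison

end PiecewiseTrivial

theorem mainTheorem7 {Γ : Type*} [Group Γ]
    (G G' : Subgroup Γ) (hG : PiecewiseTrivial.IsCSA G) (hG' : PiecewiseTrivial.IsCSA G')
    (α : MulAut G) (t : Γ) (hs : PiecewiseTrivial.IsSuspension G α t)
    (α' : MulAut G') (t' : Γ) (hs' : PiecewiseTrivial.IsSuspension G' α' t')
    {V V' : Type*} [MulAction Γ V] [MulAction Γ V']
    (T : SimpleGraph V) (T' : SimpleGraph V')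
    (hT : PiecewiseTrivial.IsPiecewiseTrivialSuspension G t T)
    (hT' : PiecewiseTrivial.IsPiecewiseTrivialSuspension G' t' T')
    (hmin : PiecewiseTrivial.IsMinimalTree Γ T) (hmin' : PiecewiseTrivial.IsMinimalTree Γ T') :
    ∃ f : T ≃g T', ∀ (g : Γ) (v : V), f (g • v) = g • f v := by
  by_cases hΓ : ∃ x y : Γ, ¬ Commute x y
  · choose f hf using hT.exists_corresponds hT' hmin hmin' hG hG' hs hs' hΓ
    choose f' hf' using hT'.exists_corresponds hT hmin' hmin hG' hG hs' hs hΓ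
    have huniq : ∀ {v w w'}, PiecewiseTrivial.Corresponds T T' Γ v w →
        PiecewiseTrivial.Corresponds T T' Γ v w' → w = w' :=
      fun h h' => hT.eq_of_corresponds hT' hmin hmin' hG hs hs' hΓ h h'
    have huniq' : ∀ {w v v'}, PiecewiseTrivial.Corresponds T' T Γ w v →
        PiecewiseTrivial.Corresponds T' T Γ w v' → v = v' :=
      fun h h' => hT'.eq_of_corresponds hT hmin' hmin hG' hs' hs hΓ h h'
    exact ⟨⟨⟨f, f', fun v => huniq' (hf' (f v)) (hf v).symm,
      fun w => huniq (hf (f' w)) (hf' w).symm⟩, fun {v w} =>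
        ⟨(hf v).symm.adj hT'.bipartite (hf w).symm, (hf v).adj hT.bipartite (hf w)⟩⟩,
      fun g v => huniq (hf (g • v)) ((hf v).smul hT.isGroupTree hT'.isGroupTree g)⟩
  -- If `Γ` is abelian, every vertex is black and there are no edges, so each tree is a point.
  · push Not at hΓ
    have := hT.subsingleton_of_comm hΓ
    have := hT'.subsingleton_of_comm hΓ
    obtain ⟨v⟩ := hT.isGroupTree.isTree.connected.nonempty
    obtain ⟨w⟩ := hT'.isGroupTree.isTree.connected.nonempty
    exact ⟨⟨⟨fun _ => w, fun _ => v, fun _ => Subsingleton.elim _ _,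
      fun _ => Subsingleton.elim _ _⟩, fun {a b} => by
        simp [Subsingleton.elim a b]⟩, fun _ _ => Subsingleton.elim _ _⟩
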